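/- Let $n\ge 0$ and $\Omega=\begin{bmatrix}0&I_n\\-I_n&0\end{bmatrix}$. A *phase matrix* is a complex symmetric $n\times n$ matrix $\Phi$ with $\mathrm{Im}(\Phi)\succ0$. An *$n$-qumode Gaussian state* with phase matrix $\Phi$ and displacement $(s,t)\in\mathbb R^n\times\mathbb R^n$ is a function in $L^2(\mathbb R^n)$ of the form $$\varphi(x)=e^{i\alpha}e^{is^{T}x}\Big(\tfrac{\det \mathrm{Im}(\Phi)}{\pi^n}\Big)^{1/4}\exp\!\big(\tfrac i2(x-t)^{T}\Phi(x-t)\big),\qquad \alpha\in[0,2\pi),$$ and its *Wigner transform* is $$W_\varphi(q,p)=\frac1{\pi^n}\int_{\mathbb R^n}\overline{\varphi(q+\xi)}\,\varphi(q-\xi)\,e^{2i\xi^{T}p}\,d\xi ,\qquad (q,p)\in\mathbb R^{2n}.$$ Let $\mathcal N(S,m)$ denote the Gaussian distribution with covariance matrix $S$ and mean $m$; if $S\succ0$, its density on $\mathbb R^{2n}$ is $u\mapsto \exp(-\frac12(u-m)^{T}S^{-1}(u-m))/\sqrt{(2\pi)^{2n}\det S}$. Call a real symmetric $2n\times2n$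 matrix $\Delta$ *pure* if $\det\Delta=1$ and $\Delta+i\Omega\succeq0$. (1) The function $\varphi$ above is square integrable for every phase matrix $\Phi$, all $s,t\in\mathbb R^n$ and all $\alpha\in\mathbb R$. If $\varphi$ is a Gaussian state with phase matrix $\Phi$ and displacement $(s,t)$, put $$\Sigma=\begin{bmatrix}\mathrm{Im}(\Phi)+\mathrm{Re}(\Phi)\mathrm{Im}(\Phi)^{-1}\mathrm{Re}(\Phi)&-\mathrm{Re}(\Phi)\mathrm{Im}(\Phi)^{-1}\\-\mathrm{Im}(\Phi)^{-1}\mathrm{Re}(\Phi)&\mathrm{Im}(\Phi)^{-1}\end{bmatrix},\qquad m=\begin{bmatrix}t\\s\end{bmatrix}.$$ Then $\Sigma$ is pure, and for all $u=\begin{bmatrix}q\\p\end{bmatrix}\in\mathbb R^{2n}$ $$W_\varphi(u)=\pi^{-n}\exp\!\big(-(u-m)^{T}\Sigma\,(u-m)\big);$$ that is, $W_\varphi$ is the density of $\mathcal N(\tfrac12\Sigma^{-1},m)$. Moreover, the image of this distribution under the linear map $\sqrt2\,\Omega:(q,p)\mapsto\sqrt2\,(p,-q)$ is $\mathcal N\big(\Sigma,\sqrt2\,(s,-t)\big)$.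 (2) Conversely, let $\Delta=\begin{bmatrix}A&B\\B^{T}&C\end{bmatrix}$ with $A,C$ real symmetric and $B$ real $n\times n$, and suppose that $\Delta$ is pure. Then $C$ is invertible, $\Phi=-BC^{-1}+iC^{-1}$ is a phase matrix, and its matrix $\Sigma$ equals $\Delta$. For all $s,t\in\mathbb R^n$, a Gaussian state has as Wigner transform the density of $\mathcal N\big(\tfrac12\Delta^{-1},(t,s)\big)$ if and only if it has phase matrix $\Phi$ and displacement $(s,t)$. (3) Distinct pairs $(\Delta,m)$, with $\Delta$ pure and $m\in\mathbb R^{2n}$, give distinct distributions $\mathcal N(\frac12\Delta^{-1},m)$, and $\varphi\mapsto W_\varphi$ induces a bijection from the set of Gaussian states modulo global phase ($\varphi\sim e^{i\theta}\varphi$, $\theta\in\mathbb R$) onto the set of densities of the distributions $\mathcal N(\frac12\Delta^{-1},m)$ with $\Delta$ pure and $m\in\mathbb R^{2n}$. -/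

import Mathlib

open MeasureTheory ProbabilityTheory
open scoped ComplexOrder Matrix

noncomputable section

namespace GaussWigner

/-- Configuration space `ℝⁿ`. -/
abbrev Config (n : ℕ) : Type := EuclideanSpace ℝ (Fin n)

/-- Phase space `ℝ²ⁿ`; a point is a column `[q; p]` with blocks `q` (left summand) and `p`
(right summand). -/
abbrev Phase (n : ℕ) : Type := EuclideanSpace ℝ (Fin n ⊕ Fin n)

/-- The column `[q; p]`. -/
def column {n : ℕ} (q p : Config n) : Phase n :=
  WithLp.toLp 2 (Sum.elim (fun i => q i) (fun i => p i))

/-- The upper block of a point of phase space. -/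
def upper {n : ℕ} (u : Phase n) : Config n := WithLp.toLp 2 (fun i => u (Sum.inl i))

/-- The lower block of a point of phase space. -/
def lower {n : ℕ} (u : Phase n) : Config n := WithLp.toLp 2 (fun i => u (Sum.inr i))

/-- Entrywise real part. -/
def reMat {n : ℕ} (Φ : Matrix (Fin n) (Fin n) ℂ) : Matrix (Fin n) (Fin n) ℝ := Φ.map Complex.re

/-- Entrywise imaginary part. -/
def imMat {n : ℕ} (Φ : Matrix (Fin n) (Fin n) ℂ) : Matrix (Fin n) (Fin n) ℝ := Φ.map Complex.im

/-- A phase matrix: complex symmetric with positive definite imaginary part. -/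
def IsPhaseMatrix {n : ℕ} (Φ : Matrix (Fin n) (Fin n) ℂ) : Prop :=
  Φ.IsSymm ∧ (imMat Φ).PosDef

/-- The wave function
`exp(iα) exp(i sᵀx) (det(Im Φ)/πⁿ)^(1/4) exp(i (x - t)ᵀ Φ (x - t) / 2)`. -/
def gaussianWave {n : ℕ} (α : ℝ) (s t : Config n) (Φ : Matrix (Fin n) (Fin n) ℂ)
    (x : Config n) : ℂ :=
  Complex.exp (Complex.I * α) * Complex.exp (Complex.I * ((∑ i, s i * x i : ℝ) : ℂ)) *
    ((((imMat Φ).det / Real.pi ^ n) ^ (1 / 4 : ℝ) : ℝ) : ℂ) *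
    Complex.exp (Complex.I *
      ((fun i => ((x i - t i : ℝ) : ℂ)) ⬝ᵥ Φ *ᵥ (fun i => ((x i - t i : ℝ) : ℂ))) / 2)

/-- `L²(ℝⁿ)`. -/
abbrev L2 (n : ℕ) : Type := Lp ℂ 2 (volume : Measure (Config n))

/-- `ψ` is a Gaussian state with phase matrix `Φ` and displacement `[s; t]`. -/
def IsGaussianWith {n : ℕ} (ψ : L2 n) (s t : Config n) (Φ : Matrix (Fin n) (Fin n) ℂ) : Prop :=
  IsPhaseMatrix Φ ∧ ∃ α ∈ Set.Ico (0 : ℝ) (2 * Real.pi), ψ =ᵐ[volume] gaussianWave α s t Φ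

/-- The `n`-qumode Gaussian states. -/
def GaussianState (n : ℕ) : Type :=
  {ψ : L2 n // ∃ (s t : Config n) (Φ : Matrix (Fin n) (Fin n) ℂ), IsGaussianWith ψ s t Φ}

/-- Two Gaussian states are equivalent if they differ by a global phase `exp(iθ)`. -/
def phaseSetoid (n : ℕ) : Setoid (GaussianState n) where
  r ψ χ := ∃ θ : ℝ, χ.1 = Complex.exp (Complex.I * θ) • ψ.1
  iseqv :=
    { refl := fun ψ => ⟨0, by simp⟩
      symm := by
        rintro ψ χ ⟨θ, h⟩
        refine ⟨-θ, ?_⟩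
        rw [h, smul_smul, ← Complex.exp_add]
        simp
      trans := by
        rintro ψ χ ρ ⟨θ, h⟩ ⟨η, k⟩
        refine ⟨η + θ, ?_⟩
        rw [k, h, smul_smul, ← Complex.exp_add]
        congr 2
        push_cast
        ring }

/-- The Wigner transform
`W([q; p]) = π⁻ⁿ ∫ conj (φ (q + ξ)) φ (q - ξ) exp(2i ξᵀp) dξ`. -/
def wigner {n : ℕ} (φ : Config n → ℂ) (u : Phase n) : ℂ :=
  (1 / (Real.pi : ℂ) ^ n) * ∫ ξ : Config n,
    starRingEnd ℂ (φ (upper u + ξ)) * φ (upper u - ξ) *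
      Complex.exp (2 * Complex.I * ((∑ i, ξ i * lower u i : ℝ) : ℂ))

/-- The Wigner transform depends only on the class of the function in `L²`. -/
theorem wigner_congr_ae {n : ℕ} {φ χ : Config n → ℂ} (h : φ =ᵐ[volume] χ) :
    wigner φ = wigner χ := by
  funext u
  unfold wigner
  congr 1
  apply integral_congr_ae
  have h1 : ∀ᵐ ξ : Config n, φ (upper u + ξ) = χ (upper u + ξ) :=
    (measurePreserving_add_left volume (upper u)).quasiMeasurePreserving.ae h
  have h2 : ∀ᵐ ξ : Config n, φ (upper u - ξ) = χ (upper u - ξ) :=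
    (Measure.measurePreserving_sub_left volume (upper u)).quasiMeasurePreserving.ae h
  filter_upwards [h1, h2] with ξ a b
  rw [a, b]

/-- The Wigner transform is invariant under a global phase. -/
theorem wigner_phase {n : ℕ} (θ : ℝ) (ψ : L2 n) :
    wigner (Complex.exp (Complex.I * θ) • ψ : L2 n) = wigner ψ := by
  rw [wigner_congr_ae (Lp.coeFn_smul _ ψ)]
  funext u
  unfold wigner
  congr 1
  congr 1
  funext ξ
  have h : starRingEnd ℂ (Complex.exp (Complex.I * θ)) * Complex.exp (Complex.I * θ) = 1 := by
    rw [← Complex.exp_conj, ← Complex.exp_add]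
    simp
  simp only [Pi.smul_apply, smul_eq_mul, map_mul]
  linear_combination (starRingEnd ℂ (ψ (upper u + ξ)) * ψ (upper u - ξ) *
      Complex.exp (2 * Complex.I * ((∑ i, ξ i * lower u i : ℝ) : ℂ))) * h

/-- The Wigner transform on Gaussian states modulo global phase. -/
def wignerRay (n : ℕ) : Quotient (phaseSetoid n) → Phase n → ℂ :=
  Quotient.lift (fun ψ : GaussianState n => wigner ψ.1) (by
    rintro ψ χ ⟨θ, h⟩
    change wigner ψ.1 = wigner χ.1
    rw [h, wigner_phase])

/-- The matrix `Ω` of the standard symplectic form. -/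
def Omega (n : ℕ) : Matrix (Fin n ⊕ Fin n) (Fin n ⊕ Fin n) ℝ := Matrix.fromBlocks 0 1 (-1) 0

/-- `Δ` is symmetric, `det Δ = 1` and `Δ + iΩ ⪰ 0`. -/
def IsPure {n : ℕ} (Δ : Matrix (Fin n ⊕ Fin n) (Fin n ⊕ Fin n) ℝ) : Prop :=
  Δ.IsSymm ∧ Δ.det = 1 ∧
    (Δ.map Complex.ofReal + Complex.I • (Omega n).map Complex.ofReal).PosSemidef

/-- The matrix `Σ` attached to a phase matrix. -/
def sigmaOf {n : ℕ} (Φ : Matrix (Fin n) (Fin n) ℂ) :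
    Matrix (Fin n ⊕ Fin n) (Fin n ⊕ Fin n) ℝ :=
  Matrix.fromBlocks
    (imMat Φ + reMat Φ * (imMat Φ)⁻¹ * reMat Φ) (-(reMat Φ * (imMat Φ)⁻¹))
    (-((imMat Φ)⁻¹ * reMat Φ)) (imMat Φ)⁻¹

/-- The phase matrix `-B C⁻¹ + i C⁻¹`. -/
def phaseOf {n : ℕ} (B C : Matrix (Fin n) (Fin n) ℝ) : Matrix (Fin n) (Fin n) ℂ :=
  (-(B * C⁻¹)).map Complex.ofReal + Complex.I • (C⁻¹).map Complex.ofReal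

/-- The density of the Gaussian distribution with covariance matrix `S ≻ 0` and mean `m`:
`exp(-(u - m)ᵀ S⁻¹ (u - m) / 2) / √((2π)^N det S)`, where `N = 2n`. -/
def gaussianDensity {n : ℕ} (S : Matrix (Fin n ⊕ Fin n) (Fin n ⊕ Fin n) ℝ) (m u : Phase n) : ℝ :=
  Real.exp (-(1 / 2) * ((fun i => u i - m i) ⬝ᵥ S⁻¹ *ᵥ (fun i => u i - m i))) /
    Real.sqrt ((2 * Real.pi) ^ (2 * n) * S.det)

/-- `f` is the density function of the Gaussian distribution with (positive definite) covariance
matrix `S` and mean `m`: it is given everywhere by the explicit formula, and it is a density, with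
respect to Lebesgue measure, of the Gaussian measure. -/
def IsDensityOfGaussian {n : ℕ} (f : Phase n → ℂ)
    (S : Matrix (Fin n ⊕ Fin n) (Fin n ⊕ Fin n) ℝ) (m : Phase n) : Prop :=
  S.PosDef ∧ (∀ u, f u = (gaussianDensity S m u : ℂ)) ∧
    volume.withDensity (fun u => ENNReal.ofReal (f u).re) = multivariateGaussian m S

/-- The linear map `√2 Ω : [q; p] ↦ √2 [p; -q]` of phase space. -/
def rescaledRotation {n : ℕ} (u : Phase n) : Phase n :=
  column (Real.sqrt 2 • lower u) (-(Real.sqrt 2 • upper u))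

end GaussWigner

end

/-! Write Φ = X + iY. In the product of the conjugate of φ(q + ξ) with φ(q - ξ), put a = q - t. The
squares in X cancel and leave only the cross term -2i aᵀXξ, while those in Y add up to -aᵀYa - ξᵀYξ.
So the Wigner transform is the Fourier integral of a centred Gaussian with matrix Y at the frequency
b = p - s - Xa, and its value is π⁻ⁿ exp(-aᵀYa - bᵀY⁻¹b). This exponent is minus the quadratic form
of Σ, which is Y ⊕ Y⁻¹ after the shear b = (p - s) - Xa (`integral_cexp_quadForm`,
`wigner_integrand`, `sigmaOf_quadForm`).

Σ is pure because the Schur complement of its block Y⁻¹ is Y, and because Σ + iΩ = V Y⁻¹ Vᴴ for an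
explicit block column V.

The converse rests on `IsPure.mul_Omega_mul`: a pure Δ satisfies ΔΩΔ = Ω. A congruence turning Δ
into 1 turns iΩ into a Hermitian K with 1 ± K ⪰ 0 and |det K| = 1. All eigenvalues of K are then ±1,
so K² = 1, which is the symplectic relation. Its blocks say that BC⁻¹ is symmetric and that A is
determined by B and C, so Δ is the Σ of -BC⁻¹ + iC⁻¹.

For uniqueness, a Gaussian measure determines its mean and covariance, the lower blocks of Σ
determine Φ, and two states with equal parameters differ only by the phase α. -/

namespace GaussWigner

/-! ### Gaussian integrals with a positive definite matrix -/

section GaussianIntegrals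

variable {ι : Type*} [Fintype ι] [DecidableEq ι]

/-- A positive definite matrix factors as `Rᴴ R` with `R` invertible. -/
theorem exists_conjTranspose_mul_self {𝕜 : Type*} [RCLike 𝕜] {Y : Matrix ι ι 𝕜} (hY : Y.PosDef) :
    ∃ R : Matrix ι ι 𝕜, Y = Rᴴ * R ∧ IsUnit R.det := by
  open scoped MatrixOrder in
  obtain ⟨R, hR⟩ := CStarAlgebra.nonneg_iff_eq_star_mul_self.mp hY.posSemidef.nonneg
  refine ⟨R, hR, ?_⟩
  have h := (Matrix.isUnit_iff_isUnit_det _).mp hY.isUnit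
  rw [hR, Matrix.det_mul] at h
  exact isUnit_of_mul_isUnit_right h

theorem dotProduct_transpose_mul_self_mulVec {ι : Type*} [Fintype ι] (R : Matrix ι ι ℝ) (x : ι → ℝ) :
    x ⬝ᵥ (Rᵀ * R) *ᵥ x = (R *ᵥ x) ⬝ᵥ (R *ᵥ x) := by
  rw [← Matrix.mulVec_mulVec, Matrix.dotProduct_mulVec, Matrix.vecMul_transpose]

theorem map_toEuclideanLin_volume {R : Matrix ι ι ℝ} (hR : IsUnit R.det) :
    (volume : Measure (EuclideanSpace ℝ ι)).map (Matrix.toEuclideanLin R) =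
      ENNReal.ofReal |R.det⁻¹| • volume := by
  have h : LinearMap.det (Matrix.toEuclideanLin R) = R.det := LinearMap.det_toLpLin 2 R
  rw [Measure.map_linearMap_addHaar_eq_smul_addHaar _ (by rw [h]; exact hR.ne_zero), h]

theorem measurableEmbedding_toEuclideanLin {R : Matrix ι ι ℝ} (hR : IsUnit R.det) :
    MeasurableEmbedding (Matrix.toEuclideanLin R : EuclideanSpace ℝ ι → EuclideanSpace ℝ ι) := by
  have h : LinearMap.det (Matrix.toEuclideanLin R) = R.det := LinearMap.det_toLpLin 2 R
  let e := (LinearEquiv.ofIsUnitDet (f := Matrix.toEuclideanLin R)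
    (v := (EuclideanSpace.basisFun ι ℝ).toBasis) (v' := (EuclideanSpace.basisFun ι ℝ).toBasis)
    (by rw [LinearMap.det_toMatrix, h]; exact hR))
  exact e.toContinuousLinearEquiv.toHomeomorph.measurableEmbedding

/-- The oscillating Gaussian with matrix `Rᵀ R`, in the coordinates `R x`. -/
theorem cexp_quadForm_eq {R : Matrix ι ι ℝ} (hR : IsUnit R.det) (b : ι → ℝ)
    (x : EuclideanSpace ℝ ι) :
    Complex.exp (-((x.ofLp ⬝ᵥ (Rᵀ * R) *ᵥ x.ofLp : ℝ) : ℂ) +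
        2 * Complex.I * ((b ⬝ᵥ x.ofLp : ℝ) : ℂ)) =
      Complex.exp (-1 * (‖Matrix.toEuclideanLin R x‖ : ℂ) ^ 2 + 2 * Complex.I *
        (inner ℝ (WithLp.toLp 2 ((R⁻¹)ᵀ *ᵥ b) : EuclideanSpace ℝ ι)
          (Matrix.toEuclideanLin R x) : ℝ)) := by
  have h1 : ‖Matrix.toEuclideanLin R x‖ ^ 2 = x.ofLp ⬝ᵥ (Rᵀ * R) *ᵥ x.ofLp := by
    rw [dotProduct_transpose_mul_self_mulVec, EuclideanSpace.real_norm_sq_eq]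
    simp [dotProduct, sq, Matrix.toLpLin_apply]
  -- The frequency (R⁻¹)ᵀ b is the one whose pairing with R x is b ⬝ᵥ x.
  have h2 : inner ℝ (WithLp.toLp 2 ((R⁻¹)ᵀ *ᵥ b) : EuclideanSpace ℝ ι)
      (Matrix.toEuclideanLin R x) = b ⬝ᵥ x.ofLp := by
    rw [EuclideanSpace.inner_eq_star_dotProduct]
    simp only [Matrix.toLpLin_apply, star_trivial]
    rw [Matrix.mulVec_transpose, dotProduct_comm, ← Matrix.dotProduct_mulVec, Matrix.mulVec_mulVec,
      Matrix.nonsing_inv_mul _ hR, Matrix.one_mulVec]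
  rw [h2, ← h1]
  push_cast
  ring_nf

theorem integrable_cexp_quadForm {Y : Matrix ι ι ℝ} (hY : Y.PosDef) (b : ι → ℝ) :
    Integrable (fun x : EuclideanSpace ℝ ι =>
      Complex.exp (-((x.ofLp ⬝ᵥ Y *ᵥ x.ofLp : ℝ) : ℂ) +
        2 * Complex.I * ((b ⬝ᵥ x.ofLp : ℝ) : ℂ))) := by
  obtain ⟨R, rfl, hR⟩ := exists_conjTranspose_mul_self hY
  rw [Matrix.conjTranspose_eq_transpose_of_trivial]
  simp_rw [cexp_quadForm_eq hR]
  have h := GaussianFourier.integrable_cexp_neg_mul_sq_norm_add (b := 1) (by simp)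
    (2 * Complex.I) (WithLp.toLp 2 ((R⁻¹)ᵀ *ᵥ b) : EuclideanSpace ℝ ι)
  have h' := h.smul_measure (c := ENNReal.ofReal |R.det⁻¹|) ENNReal.ofReal_ne_top
  rw [← map_toEuclideanLin_volume hR, (measurableEmbedding_toEuclideanLin hR).integrable_map_iff]
    at h'
  exact h'

/-- The Fourier transform of a centred Gaussian. -/
theorem integral_cexp_quadForm {Y : Matrix ι ι ℝ} (hY : Y.PosDef) (b : ι → ℝ) :
    ∫ x : EuclideanSpace ℝ ι, Complex.exp (-((x.ofLp ⬝ᵥ Y *ᵥ x.ofLp : ℝ) : ℂ) +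
        2 * Complex.I * ((b ⬝ᵥ x.ofLp : ℝ) : ℂ)) =
      ((Real.sqrt (Real.pi ^ Fintype.card ι / Y.det) * Real.exp (-(b ⬝ᵥ Y⁻¹ *ᵥ b)) : ℝ) : ℂ) := by
  obtain ⟨R, rfl, hR⟩ := exists_conjTranspose_mul_self hY
  rw [Matrix.conjTranspose_eq_transpose_of_trivial]
  simp_rw [cexp_quadForm_eq hR]
  have h := GaussianFourier.integral_cexp_neg_mul_sq_norm_add (b := 1) (by simp)
    (2 * Complex.I) (WithLp.toLp 2 ((R⁻¹)ᵀ *ᵥ b) : EuclideanSpace ℝ ι)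
  have hm := (measurableEmbedding_toEuclideanLin hR).integral_map (μ := volume)
    (fun v : EuclideanSpace ℝ ι => Complex.exp (-1 * (‖v‖ : ℂ) ^ 2 + 2 * Complex.I *
        (inner ℝ (WithLp.toLp 2 ((R⁻¹)ᵀ *ᵥ b) : EuclideanSpace ℝ ι) v : ℝ)))
  -- In the coordinate R x the Gaussian is isotropic. The Jacobian |det R|⁻¹ supplies the factor
  -- (det Y)^(-1/2), and the squared norm of the new frequency is bᵀY⁻¹b.
  rw [← hm, map_toEuclideanLin_volume hR, integral_smul_measure, h,
    ENNReal.toReal_ofReal (abs_nonneg _)]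
  have hn : ‖(WithLp.toLp 2 ((R⁻¹)ᵀ *ᵥ b) : EuclideanSpace ℝ ι)‖ ^ 2 =
      b ⬝ᵥ (Rᵀ * R)⁻¹ *ᵥ b := by
    rw [EuclideanSpace.real_norm_sq_eq, Matrix.mul_inv_rev, ← Matrix.transpose_nonsing_inv,
      ← Matrix.mulVec_mulVec, Matrix.dotProduct_mulVec, ← Matrix.mulVec_transpose]
    simp [dotProduct, sq]
  have hd : Real.sqrt (Real.pi ^ Fintype.card ι / (Rᵀ * R).det) =
      |R.det⁻¹| * Real.pi ^ ((Fintype.card ι : ℝ) / 2) := by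
    rw [Matrix.det_mul, Matrix.det_transpose, Real.sqrt_div (by positivity), Real.sqrt_mul_self_eq_abs,
      Real.sqrt_eq_rpow, ← Real.rpow_natCast, ← Real.rpow_mul Real.pi_pos.le, abs_inv]
    ring_nf
  rw [hd, ← hn]
  have hp : ((Real.pi : ℂ) / 1) ^ ((Module.finrank ℝ (EuclideanSpace ℝ ι) : ℂ) / 2) =
      ((Real.pi ^ ((Fintype.card ι : ℝ) / 2) : ℝ) : ℂ) := by
    rw [Complex.ofReal_cpow Real.pi_pos.le]
    simp
  rw [hp, Complex.real_smul]
  push_cast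
  rw [mul_assoc]
  congr 3
  rw [mul_pow, Complex.I_sq]
  ring

theorem integrable_exp_neg_quadForm {Y : Matrix ι ι ℝ} (hY : Y.PosDef) :
    Integrable (fun x : EuclideanSpace ℝ ι => Real.exp (-(x.ofLp ⬝ᵥ Y *ᵥ x.ofLp))) := by
  have h := (integrable_cexp_quadForm hY 0).norm
  simpa [Complex.norm_exp] using h

end GaussianIntegrals

/-! ### Gaussian measures: linear images, uniqueness, explicit density -/

section MultivariateGaussian

variable {ι : Type*} [Fintype ι] [DecidableEq ι]

/-- Both sides have the same characteristic function: moving M across the inner product evaluates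
that of the original measure at Mᵀx. -/
theorem map_multivariateGaussian (m : EuclideanSpace ℝ ι) {S : Matrix ι ι ℝ} (hS : S.PosSemidef)
    (M : Matrix ι ι ℝ) :
    (multivariateGaussian m S).map (Matrix.toEuclideanCLM (𝕜 := ℝ) M) =
      multivariateGaussian (Matrix.toEuclideanCLM (𝕜 := ℝ) M m) (M * S * Mᵀ) := by
  have hM : (M * S * Mᵀ).PosSemidef := by
    simpa using hS.mul_mul_conjTranspose_same M
  apply Measure.ext_of_charFun
  ext x
  rw [charFun_multivariateGaussian hM, charFun_apply,
    integral_map (by fun_prop) (by fun_prop)]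
  have h1 : ∀ y, inner ℝ (Matrix.toEuclideanCLM (𝕜 := ℝ) M y) x =
      inner ℝ y (Matrix.toEuclideanCLM (𝕜 := ℝ) Mᵀ x) := by
    intro y
    rw [Matrix.inner_toEuclideanCLM, real_inner_comm, Matrix.inner_toEuclideanCLM,
      Matrix.dotProduct_mulVec, ← Matrix.mulVec_transpose, dotProduct_comm]
  simp_rw [h1]
  rw [← charFun_apply, charFun_multivariateGaussian hS]
  congr 3
  · rw [real_inner_comm, ← h1, real_inner_comm]
  · rw [Matrix.ofLp_toEuclideanCLM, ← Matrix.mulVec_mulVec, ← Matrix.mulVec_mulVec,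
      Matrix.dotProduct_mulVec x.ofLp M, Matrix.mulVec_transpose]

/-- The measure determines S as its covariance and m as its mean. -/
theorem multivariateGaussian_injOn :
    Set.InjOn (fun x : Matrix ι ι ℝ × EuclideanSpace ℝ ι => multivariateGaussian x.2 x.1)
      {x | x.1.PosSemidef} := by
  rintro ⟨S, m⟩ hS ⟨T, k⟩ hT h
  change S.PosSemidef at hS
  change T.PosSemidef at hT
  change multivariateGaussian m S = multivariateGaussian k T at h
  refine Prod.ext ?_ ?_
  · ext i j
    change S i j = T i j
    rw [← covariance_eval_multivariateGaussian (μ := m) hS,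
      ← covariance_eval_multivariateGaussian (μ := k) hT, h]
  · change m = k
    rw [← integral_id_multivariateGaussian (μ := m) (S := S), h, integral_id_multivariateGaussian]

/-- The explicit density of a nondegenerate Gaussian measure. -/
theorem withDensity_eq_multivariateGaussian {S : Matrix ι ι ℝ} (hS : S.PosDef)
    (m : EuclideanSpace ℝ ι) :
    (volume : Measure (EuclideanSpace ℝ ι)).withDensity (fun u => ENNReal.ofReal
      (Real.exp (-(1 / 2) * ((fun i => u i - m i) ⬝ᵥ S⁻¹ *ᵥ (fun i => u i - m i))) /
        Real.sqrt ((2 * Real.pi) ^ Fintype.card ι * S.det))) = multivariateGaussian m S := by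
  have hY : ((1 / 2 : ℝ) • S⁻¹).PosDef := hS.inv.smul (by norm_num)
  have hdet : ((1 / 2 : ℝ) • S⁻¹).det = (2 ^ Fintype.card ι * S.det)⁻¹ := by
    rw [Matrix.det_smul, Matrix.det_nonsing_inv, Ring.inverse_eq_inv', mul_inv]
    simp
  have hinv : ((1 / 2 : ℝ) • S⁻¹)⁻¹ = (2 : ℝ) • S := by
    apply Matrix.inv_eq_right_inv
    rw [Matrix.smul_mul, Matrix.mul_smul, smul_smul,
      Matrix.nonsing_inv_mul _ ((Matrix.isUnit_iff_isUnit_det _).mp hS.isUnit)]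
    norm_num
  set c : ℝ := Real.sqrt ((2 * Real.pi) ^ Fintype.card ι * S.det) with hc
  have hcpos : 0 < c := Real.sqrt_pos.mpr (mul_pos (by positivity) hS.det_pos)
  have hquad : ∀ u : EuclideanSpace ℝ ι,
      -(1 / 2) * ((fun i => u i - m i) ⬝ᵥ S⁻¹ *ᵥ (fun i => u i - m i)) =
        -((u - m).ofLp ⬝ᵥ ((1 / 2 : ℝ) • S⁻¹) *ᵥ (u - m).ofLp) := by
    intro u
    rw [Matrix.smul_mulVec, dotProduct_smul, smul_eq_mul, neg_mul]
    rfl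
  simp_rw [hquad]
  have hint : Integrable (fun u : EuclideanSpace ℝ ι =>
      Real.exp (-((u - m).ofLp ⬝ᵥ ((1 / 2 : ℝ) • S⁻¹) *ᵥ (u - m).ofLp)) / c) :=
    ((integrable_exp_neg_quadForm hY).comp_sub_right m).div_const c
  have : IsFiniteMeasure ((volume : Measure (EuclideanSpace ℝ ι)).withDensity
      (fun u => ENNReal.ofReal
        (Real.exp (-((u - m).ofLp ⬝ᵥ ((1 / 2 : ℝ) • S⁻¹) *ᵥ (u - m).ofLp)) / c))) :=
    isFiniteMeasure_withDensity_ofReal hint.2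
  apply Measure.ext_of_charFun
  ext x
  rw [charFun_multivariateGaussian hS.posSemidef, charFun_apply,
    integral_withDensity_eq_integral_toReal_smul₀ hint.aemeasurable.ennreal_ofReal
      (by simp)]
  -- The frequency is x/2 because `integral_cexp_quadForm` has the oscillating factor exp(2i b·u).
  have hval := integral_cexp_quadForm hY ((1 / 2 : ℝ) • x.ofLp)
  have hsq : Real.sqrt (Real.pi ^ Fintype.card ι / ((1 / 2 : ℝ) • S⁻¹).det) = c := by
    rw [hdet, hc, div_inv_eq_mul, mul_pow]
    ring_nf
  rw [hsq, hinv] at hval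
  rw [← integral_add_right_eq_self _ m]
  have hfun : ∀ u : EuclideanSpace ℝ ι,
      (ENNReal.ofReal (Real.exp (-((u + m - m).ofLp ⬝ᵥ ((1 / 2 : ℝ) • S⁻¹) *ᵥ (u + m - m).ofLp))
        / c)).toReal • Complex.exp ((inner ℝ (u + m) x : ℝ) * Complex.I) =
      ((c : ℂ)⁻¹ * Complex.exp ((inner ℝ x m : ℝ) * Complex.I)) *
        Complex.exp (-((u.ofLp ⬝ᵥ ((1 / 2 : ℝ) • S⁻¹) *ᵥ u.ofLp : ℝ) : ℂ) +
        2 * Complex.I * ((((1 / 2 : ℝ) • x.ofLp) ⬝ᵥ u.ofLp : ℝ) : ℂ)) := by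
    intro u
    have hi : inner ℝ (u + m) x = x.ofLp ⬝ᵥ u.ofLp + inner ℝ x m := by
      rw [inner_add_left, real_inner_comm m, EuclideanSpace.inner_eq_star_dotProduct]
      simp
    rw [ENNReal.toReal_ofReal (by positivity), add_sub_cancel_right, hi, smul_dotProduct,
      Complex.real_smul, Complex.exp_add]
    push_cast
    rw [add_mul, Complex.exp_add, smul_eq_mul]
    push_cast
    ring_nf
  simp_rw [hfun]
  rw [integral_const_mul, hval]
  have hc' : (c : ℂ) ≠ 0 := by exact_mod_cast hcpos.ne'
  push_cast
  rw [mul_comm (c : ℂ)⁻¹, mul_assoc, inv_mul_cancel_left₀ hc', ← Complex.exp_add]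
  congr 1
  simp only [Matrix.smul_mulVec, Matrix.mulVec_smul, dotProduct_smul, smul_dotProduct, smul_eq_mul]
  push_cast
  ring

end MultivariateGaussian

/-! ### Real matrices seen over ℂ, and Hermitian involutions -/

section ComplexMatrices

variable {ι : Type*}

theorem map_ofReal_mul [Fintype ι] (A B : Matrix ι ι ℝ) :
    (A * B).map Complex.ofReal = A.map Complex.ofReal * B.map Complex.ofReal :=
  Matrix.map_mul (f := Complex.ofRealHom)

theorem conjTranspose_map_ofReal (A : Matrix ι ι ℝ) :
    (A.map Complex.ofReal)ᴴ = Aᵀ.map Complex.ofReal := by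
  ext i j
  simp [Matrix.conjTranspose_apply]

theorem map_ofReal_injective :
    Function.Injective (fun A : Matrix ι ι ℝ => A.map Complex.ofReal) :=
  Matrix.map_injective Complex.ofReal_injective

theorem map_ofReal_one [DecidableEq ι] : (1 : Matrix ι ι ℝ).map Complex.ofReal = 1 :=
  Matrix.map_one _ Complex.ofReal_zero Complex.ofReal_one

theorem posDef_of_map_ofReal [Fintype ι] {A : Matrix ι ι ℝ} (hA : (A.map Complex.ofReal).PosDef) :
    A.PosDef := by
  refine Matrix.PosDef.of_dotProduct_mulVec_pos ?_ fun x hx => ?_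
  · apply map_ofReal_injective
    have := hA.1
    rw [Matrix.IsHermitian, conjTranspose_map_ofReal] at this
    simpa using this
  · have hx' : (fun i => (x i : ℂ)) ≠ 0 := fun h => hx (by
      ext i
      simpa using congrFun h i)
    have h := hA.dotProduct_mulVec_pos hx'
    have e : star (fun i => (x i : ℂ)) ⬝ᵥ (A.map Complex.ofReal) *ᵥ (fun i => (x i : ℂ)) =
        ((x ⬝ᵥ A *ᵥ x : ℝ) : ℂ) := by
      simp [dotProduct, Matrix.mulVec]
    rw [e] at h
    simpa using Complex.zero_lt_real.mp h

variable [Fintype ι] [DecidableEq ι]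

theorem det_map_ofReal (A : Matrix ι ι ℝ) : (A.map Complex.ofReal).det = (A.det : ℂ) :=
  (RingHom.map_det Complex.ofRealHom A).symm

theorem posSemidef_map_ofReal {A : Matrix ι ι ℝ} (hA : A.PosDef) :
    (A.map Complex.ofReal).PosSemidef := by
  obtain ⟨R, rfl, -⟩ := exists_conjTranspose_mul_self hA
  rw [map_ofReal_mul, Matrix.conjTranspose_eq_transpose_of_trivial, ← conjTranspose_map_ofReal]
  exact Matrix.posSemidef_conjTranspose_mul_self _

/-- A Hermitian matrix with spectrum in `[-1, 1]` and determinant of modulus one is an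
involution. -/
theorem mul_self_eq_one_of_norm_det_eq_one {K : Matrix ι ι ℂ} (h₁ : (1 + K).PosSemidef)
    (h₂ : (1 - K).PosSemidef) (hd : ‖K.det‖ = 1) : K * K = 1 := by
  have hK : K.IsHermitian := by
    have := h₁.1.sub Matrix.isHermitian_one
    simpa using this
  have hle : ∀ i, |hK.eigenvalues i| ≤ 1 := by
    intro i
    set v : ι → ℂ := (hK.eigenvectorBasis i).ofLp
    have hv : K *ᵥ v = (hK.eigenvalues i : ℂ) • v := hK.mulVec_eigenvectorBasis i
    have hn : star v ⬝ᵥ v = 1 := by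
      have := hK.eigenvectorBasis.orthonormal.1 i
      have h2 := inner_self_eq_norm_sq_to_K (𝕜 := ℂ) (hK.eigenvectorBasis i)
      rw [this, EuclideanSpace.inner_eq_star_dotProduct, dotProduct_comm] at h2
      simpa using h2
    have p := h₁.dotProduct_mulVec_nonneg v
    have q := h₂.dotProduct_mulVec_nonneg v
    rw [Matrix.add_mulVec, Matrix.one_mulVec, hv, dotProduct_add, dotProduct_smul, hn] at p
    rw [Matrix.sub_mulVec, Matrix.one_mulVec, hv, dotProduct_sub, dotProduct_smul, hn] at q
    simp only [smul_eq_mul, mul_one] at p q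
    have p' : 0 ≤ 1 + hK.eigenvalues i := by exact_mod_cast p
    have q' : 0 ≤ 1 - hK.eigenvalues i := by exact_mod_cast q
    exact abs_le.mpr ⟨by linarith, by linarith⟩
  have hprod : ∏ i, |hK.eigenvalues i| = 1 := by
    rw [hK.det_eq_prod_eigenvalues, norm_prod] at hd
    simpa using hd
  -- Factors in [0, 1] whose product is 1 are all equal to 1.
  have hone : ∀ i, |hK.eigenvalues i| = 1 := by
    intro j
    refine le_antisymm (hle j) ?_
    rw [← hprod, ← Finset.mul_prod_erase _ _ (Finset.mem_univ j)]
    exact mul_le_of_le_one_right (abs_nonneg _)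
      (Finset.prod_le_one (fun i _ => abs_nonneg _) fun i _ => hle i)
  have hsq : ∀ i, hK.eigenvalues i * hK.eigenvalues i = 1 := by
    intro i
    rw [← abs_mul_abs_self, hone i, one_mul]
  have hdiag : (Matrix.diagonal (RCLike.ofReal ∘ hK.eigenvalues) : Matrix ι ι ℂ) *
      Matrix.diagonal (RCLike.ofReal ∘ hK.eigenvalues) = 1 := by
    rw [Matrix.diagonal_mul_diagonal, ← Matrix.diagonal_one]
    congr 1
    ext i
    have := hsq i
    simpa using (by exact_mod_cast this :
      (hK.eigenvalues i : ℂ) * (hK.eigenvalues i : ℂ) = 1)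
  rw [hK.spectral_theorem, ← map_mul, hdiag, map_one]

end ComplexMatrices

/-! ### Pure matrices are positive definite and symplectic -/

section Pure

variable {n : ℕ}

theorem Omega_mul_Omega : Omega n * Omega n = -1 := by
  rw [Omega, Matrix.fromBlocks_multiply, ← Matrix.fromBlocks_one, Matrix.fromBlocks_neg]
  simp

theorem Omega_transpose : (Omega n)ᵀ = -Omega n := by
  rw [Omega, Matrix.fromBlocks_transpose, Matrix.fromBlocks_neg]
  simp

/-- Transposition preserves positive semidefiniteness and turns Δ + iΩ into Δ - iΩ. The mean of the
two is Δ, which is therefore semidefinite, and det Δ = 1 makes it definite. -/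
theorem IsPure.posDef_map {Δ : Matrix (Fin n ⊕ Fin n) (Fin n ⊕ Fin n) ℝ} (h : IsPure Δ) :
    (Δ.map Complex.ofReal).PosDef := by
  obtain ⟨hs, hd, hp⟩ := h
  have ht := hp.transpose
  have e : (Δ.map Complex.ofReal + Complex.I • (Omega n).map Complex.ofReal)ᵀ =
      Δ.map Complex.ofReal - Complex.I • (Omega n).map Complex.ofReal := by
    rw [Matrix.transpose_add, Matrix.transpose_smul, ← Matrix.transpose_map, ← Matrix.transpose_map,
      hs, Omega_transpose]
    ext i j
    simp [sub_eq_add_neg]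
  rw [e] at ht
  have hsum := (hp.add ht).smul (a := (1 / 2 : ℝ)) (by norm_num)
  have e2 : (1 / 2 : ℝ) • (Δ.map Complex.ofReal + Complex.I • (Omega n).map Complex.ofReal +
      (Δ.map Complex.ofReal - Complex.I • (Omega n).map Complex.ofReal)) =
      Δ.map Complex.ofReal := by
    ext i j
    simp
    ring
  rw [e2] at hsum
  rw [hsum.posDef_iff_isUnit, Matrix.isUnit_iff_isUnit_det, det_map_ofReal, hd]
  simp

theorem IsPure.posDef {Δ : Matrix (Fin n ⊕ Fin n) (Fin n ⊕ Fin n) ℝ} (h : IsPure Δ) :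
    Δ.PosDef :=
  posDef_of_map_ofReal h.posDef_map

theorem IsPure.isUnit_det {Δ : Matrix (Fin n ⊕ Fin n) (Fin n ⊕ Fin n) ℝ} (h : IsPure Δ) :
    IsUnit Δ.det := by
  rw [h.2.1]
  exact isUnit_one

/-- A pure matrix is symplectic. -/
theorem IsPure.mul_Omega_mul {Δ : Matrix (Fin n ⊕ Fin n) (Fin n ⊕ Fin n) ℝ} (h : IsPure Δ) :
    Δ * Omega n * Δ = Omega n := by
  obtain ⟨R, hR, hRu⟩ := exists_conjTranspose_mul_self h.posDef_map
  set D : Matrix (Fin n ⊕ Fin n) (Fin n ⊕ Fin n) ℂ := Δ.map Complex.ofReal with hD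
  set H : Matrix (Fin n ⊕ Fin n) (Fin n ⊕ Fin n) ℂ :=
    Complex.I • (Omega n).map Complex.ofReal with hH
  have hp : (D + H).PosSemidef := h.2.2
  have hm : (D - H).PosSemidef := by
    have ht := hp.transpose
    have e : (D + H)ᵀ = D - H := by
      rw [hD, hH, Matrix.transpose_add, Matrix.transpose_smul, ← Matrix.transpose_map,
        ← Matrix.transpose_map, h.1, Omega_transpose]
      ext i j
      simp [sub_eq_add_neg]
    rwa [e] at ht
  have hHH : H * H = 1 := by
    rw [hH, Matrix.smul_mul, Matrix.mul_smul, smul_smul, ← map_ofReal_mul, Omega_mul_Omega,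
      Complex.I_mul_I, ← map_ofReal_one]
    ext i j
    simp
  have hRi : R * R⁻¹ = 1 := Matrix.mul_nonsing_inv _ hRu
  have hRi' : (R⁻¹)ᴴ * Rᴴ = 1 := by rw [← Matrix.conjTranspose_mul, hRi, Matrix.conjTranspose_one]
  have hRj : Rᴴ * (R⁻¹)ᴴ = 1 := by
    rw [← Matrix.conjTranspose_mul, Matrix.nonsing_inv_mul _ hRu, Matrix.conjTranspose_one]
  have hone : (R⁻¹)ᴴ * D * R⁻¹ = 1 := by
    rw [hR, ← Matrix.mul_assoc, hRi', Matrix.one_mul, hRi]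
  have hdetD : D.det = 1 := by rw [hD, det_map_ofReal, h.2.1, Complex.ofReal_one]
  -- Since det D = 1, the congruence by R⁻¹ does not change determinants, and H² = 1 forces |det H|
  -- = 1.
  have hdet : ‖((R⁻¹)ᴴ * H * R⁻¹).det‖ = 1 := by
    have e1 : ((R⁻¹)ᴴ * H * R⁻¹).det = H.det := by
      have := congrArg Matrix.det hone
      rw [Matrix.det_mul, Matrix.det_mul, hdetD, mul_one, Matrix.det_one] at this
      rw [Matrix.det_mul, Matrix.det_mul, mul_right_comm, this, one_mul]
    have e2 := congrArg (fun M => ‖Matrix.det M‖) hHH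
    simp only [Matrix.det_mul, norm_mul, Matrix.det_one, norm_one] at e2
    rw [e1]
    nlinarith [norm_nonneg H.det]
  have hK := mul_self_eq_one_of_norm_det_eq_one (K := (R⁻¹)ᴴ * H * R⁻¹)
    (by
      have := hp.conjTranspose_mul_mul_same R⁻¹
      rwa [Matrix.mul_add, Matrix.add_mul, hone] at this)
    (by
      have := hm.conjTranspose_mul_mul_same R⁻¹
      rwa [Matrix.mul_sub, Matrix.sub_mul, hone] at this) hdet
  have hDi : R⁻¹ * (R⁻¹)ᴴ * D = 1 := by
    rw [hR, Matrix.mul_assoc, ← Matrix.mul_assoc (R⁻¹)ᴴ, hRi', Matrix.one_mul,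
      Matrix.nonsing_inv_mul _ hRu]
  -- Here R⁻¹(R⁻¹)ᴴ is D⁻¹, so undoing the congruence in K² = 1 gives H D⁻¹ H = D.
  have hHD : H * (R⁻¹ * (R⁻¹)ᴴ) * H = D := by
    calc H * (R⁻¹ * (R⁻¹)ᴴ) * H
        = (Rᴴ * (R⁻¹)ᴴ) * H * (R⁻¹ * (R⁻¹)ᴴ) * H * (R⁻¹ * R) := by
          rw [hRj, Matrix.nonsing_inv_mul _ hRu, Matrix.one_mul, Matrix.mul_one]
      _ = Rᴴ * (((R⁻¹)ᴴ * H * R⁻¹) * ((R⁻¹)ᴴ * H * R⁻¹)) * R := by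
          simp only [Matrix.mul_assoc]
      _ = D := by rw [hK, Matrix.mul_one, hR]
  have hfin : D * H * D = H := by
    calc D * H * D = H * (R⁻¹ * (R⁻¹)ᴴ) * (H * H) * D := by
          conv_lhs =>
            enter [1, 1]
            rw [← hHD]
          simp only [Matrix.mul_assoc]
      _ = H := by rw [hHH, Matrix.mul_one, Matrix.mul_assoc, hDi, Matrix.mul_one]
  apply map_ofReal_injective
  have hI : Complex.I • ((Δ * Omega n * Δ).map Complex.ofReal) =
      Complex.I • ((Omega n).map Complex.ofReal) := by
    rw [map_ofReal_mul, map_ofReal_mul]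
    rw [hH, Matrix.mul_smul, Matrix.smul_mul] at hfin
    exact hfin
  exact smul_right_injective _ Complex.I_ne_zero hI

/-- The symplectic relation gives ΩΔ⁻¹ = ΔΩ. This is why √2 Ω carries the covariance ½Δ⁻¹ to Δ. -/
theorem IsPure.Omega_mul_inv_mul {Δ : Matrix (Fin n ⊕ Fin n) (Fin n ⊕ Fin n) ℝ} (h : IsPure Δ) :
    Omega n * Δ⁻¹ * (Omega n)ᵀ = Δ := by
  have e : Omega n * Δ⁻¹ = Δ * Omega n := by
    conv_lhs => rw [← h.mul_Omega_mul]
    rw [Matrix.mul_nonsing_inv_cancel_right _ _ h.isUnit_det]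
  rw [e, Omega_transpose, Matrix.mul_neg, Matrix.mul_assoc, Omega_mul_Omega]
  simp

end Pure

/-! ### The correspondence between phase matrices and pure matrices -/

section PhaseMatrices

variable {n : ℕ} {Φ : Matrix (Fin n) (Fin n) ℂ}

theorem IsPhaseMatrix.reMat_transpose (h : IsPhaseMatrix Φ) : (reMat Φ)ᵀ = reMat Φ := by
  rw [reMat, ← Matrix.transpose_map, h.1]

theorem IsPhaseMatrix.imMat_transpose (h : IsPhaseMatrix Φ) : (imMat Φ)ᵀ = imMat Φ := by
  rw [imMat, ← Matrix.transpose_map, h.1]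

theorem IsPhaseMatrix.isUnit_det (h : IsPhaseMatrix Φ) : IsUnit (imMat Φ).det :=
  (Matrix.isUnit_iff_isUnit_det _).mp h.2.isUnit

theorem reMat_add_imMat (Φ : Matrix (Fin n) (Fin n) ℂ) :
    (reMat Φ).map Complex.ofReal + Complex.I • (imMat Φ).map Complex.ofReal = Φ := by
  ext i j
  simp [reMat, imMat, mul_comm Complex.I, Complex.re_add_im]

theorem reMat_phaseOf (B C : Matrix (Fin n) (Fin n) ℝ) : reMat (phaseOf B C) = -(B * C⁻¹) := by
  ext i j
  simp [reMat, phaseOf]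

theorem imMat_phaseOf (B C : Matrix (Fin n) (Fin n) ℝ) : imMat (phaseOf B C) = C⁻¹ := by
  ext i j
  simp [imMat, phaseOf]

theorem IsPhaseMatrix.sigmaOf_isPure (h : IsPhaseMatrix Φ) : IsPure (sigmaOf Φ) := by
  have hu := h.isUnit_det
  have hX := h.reMat_transpose
  have hYi : ((imMat Φ)⁻¹)ᵀ = (imMat Φ)⁻¹ := by
    rw [Matrix.transpose_nonsing_inv, h.imMat_transpose]
  refine ⟨?_, ?_, ?_⟩
  · rw [Matrix.IsSymm, sigmaOf, Matrix.fromBlocks_transpose]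
    simp only [Matrix.transpose_add, Matrix.transpose_neg, Matrix.transpose_mul, hX, hYi,
      h.imMat_transpose, Matrix.mul_assoc]
  · have hui : IsUnit ((imMat Φ)⁻¹).det := Matrix.isUnit_nonsing_inv_det _ hu
    let := Matrix.invertibleOfIsUnitDet _ hui
    rw [sigmaOf, Matrix.det_fromBlocks₂₂, Matrix.invOf_eq_nonsing_inv,
      Matrix.nonsing_inv_nonsing_inv _ hu]
    -- The Schur complement of the lower right block Y⁻¹ is Y, so the two determinants multiply to
    -- 1.
    have e : imMat Φ + reMat Φ * (imMat Φ)⁻¹ * reMat Φ -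
        -(reMat Φ * (imMat Φ)⁻¹) * imMat Φ * -((imMat Φ)⁻¹ * reMat Φ) = imMat Φ := by
      rw [Matrix.neg_mul, Matrix.nonsing_inv_mul_cancel_right _ _ hu]
      simp [Matrix.mul_assoc]
    rw [e, ← Matrix.det_mul, Matrix.nonsing_inv_mul _ hu, Matrix.det_one]
  · have hP := posSemidef_map_ofReal h.2.inv
    set X := (reMat Φ).map Complex.ofReal with hXd
    set Y := (imMat Φ).map Complex.ofReal with hYd
    set Z := ((imMat Φ)⁻¹).map Complex.ofReal with hZd
    have hYZ : Y * Z = 1 := by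
      rw [hYd, hZd, ← map_ofReal_mul, Matrix.mul_nonsing_inv _ hu, map_ofReal_one]
    have hZY : Z * Y = 1 := by
      rw [hYd, hZd, ← map_ofReal_mul, Matrix.nonsing_inv_mul _ hu, map_ofReal_one]
    have hXH : Xᴴ = X := by rw [hXd, conjTranspose_map_ofReal, hX]
    have hYH : Yᴴ = Y := by rw [hYd, conjTranspose_map_ofReal, h.imMat_transpose]
    -- With V the block column [Y + iX; -i], the product V Y⁻¹ Vᴴ is Σ + iΩ. The terms ±iX cancel in
    -- the upper left block, and the off-diagonal blocks acquire ±i.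
    have key := hP.mul_mul_conjTranspose_same
      (Matrix.fromRows (Y + Complex.I • X) (-Complex.I • (1 : Matrix (Fin n) (Fin n) ℂ)))
    convert key using 1
    rw [Matrix.conjTranspose_fromRows_eq_fromCols_conjTranspose, Matrix.fromRows_mul,
      Matrix.fromRows_mul_fromCols, sigmaOf, Matrix.fromBlocks_map, Omega, Matrix.fromBlocks_map,
      Matrix.fromBlocks_smul, Matrix.fromBlocks_add, Matrix.conjTranspose_add,
      Matrix.conjTranspose_smul, Matrix.conjTranspose_smul, hXH, hYH, Matrix.conjTranspose_one]
    have hmapadd : ∀ A B : Matrix (Fin n) (Fin n) ℝ,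
      (A + B).map Complex.ofReal = A.map Complex.ofReal + B.map Complex.ofReal := by
        intro A B
        ext i j
        simp
    have hmapneg : ∀ A : Matrix (Fin n) (Fin n) ℝ,
      (-A).map Complex.ofReal = -(A.map Complex.ofReal) := by
        intro A
        ext i j
        simp
    have hmapzero : (0 : Matrix (Fin n) (Fin n) ℝ).map Complex.ofReal = 0 := by
      ext i j
      simp
    simp only [hmapadd, hmapneg, hmapzero, map_ofReal_mul, map_ofReal_one, ← hXd, ← hYd, ← hZd]
    have hs1 : star Complex.I = -Complex.I := Complex.conj_I
    have hs2 : star (-Complex.I) = Complex.I := by rw [star_neg, hs1, neg_neg]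
    rw [hs1, hs2]
    congr 1
    · simp only [Matrix.add_mul, Matrix.mul_add, Matrix.smul_mul, Matrix.mul_smul, hYZ,
        Matrix.one_mul]
      rw [Matrix.mul_assoc X Z Y, hZY, Matrix.mul_one]
      simp only [smul_add, smul_smul, neg_mul, Complex.I_mul_I, neg_neg, one_smul, neg_smul,
        smul_zero]
      abel
    · simp only [Matrix.add_mul, Matrix.smul_mul, Matrix.mul_smul, smul_smul, hYZ,
        Matrix.mul_one, smul_add, Complex.I_mul_I, neg_smul, one_smul]
      abel
    · simp only [Matrix.mul_add, Matrix.smul_mul, Matrix.mul_smul, smul_smul, hZY,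
        Matrix.one_mul, neg_mul, mul_neg, neg_neg, Complex.I_mul_I, neg_smul, one_smul, smul_neg]
      abel
    · simp only [Matrix.smul_mul, Matrix.mul_smul, smul_smul, Matrix.one_mul, Matrix.mul_one,
        mul_neg, Complex.I_mul_I, neg_neg, one_smul, smul_zero, add_zero]

/-- The lower blocks -Y⁻¹X and Y⁻¹ suffice to recover Y and then X. -/
theorem sigmaOf_injective {Ψ : Matrix (Fin n) (Fin n) ℂ} (hΦ : IsPhaseMatrix Φ)
    (hΨ : IsPhaseMatrix Ψ) (h : sigmaOf Φ = sigmaOf Ψ) : Φ = Ψ := by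
  rw [sigmaOf, sigmaOf, Matrix.fromBlocks_inj] at h
  obtain ⟨-, -, h3, h4⟩ := h
  have hY : imMat Φ = imMat Ψ := by
    rw [← Matrix.nonsing_inv_nonsing_inv _ hΦ.isUnit_det, h4,
      Matrix.nonsing_inv_nonsing_inv _ hΨ.isUnit_det]
  have hX : reMat Φ = reMat Ψ := by
    have e := congrArg (fun M => imMat Ψ * M) (neg_injective h3)
    rwa [hY, Matrix.mul_nonsing_inv_cancel_left _ _ hΨ.isUnit_det,
      Matrix.mul_nonsing_inv_cancel_left _ _ hΨ.isUnit_det] at e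
  rw [← reMat_add_imMat Φ, ← reMat_add_imMat Ψ, hX, hY]

/-- A pure matrix is the matrix of the phase matrix built from its right-hand blocks. -/
theorem IsPure.phaseOf_blocks {A B C : Matrix (Fin n) (Fin n) ℝ}
    (h : IsPure (Matrix.fromBlocks A B Bᵀ C)) :
    IsUnit C.det ∧ IsPhaseMatrix (phaseOf B C) ∧
      sigmaOf (phaseOf B C) = Matrix.fromBlocks A B Bᵀ C := by
  have hC : C.PosDef := by
    have := h.posDef.submatrix (e := (Sum.inr : Fin n → Fin n ⊕ Fin n)) Sum.inr_injective
    exact this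
  have hu : IsUnit C.det := (Matrix.isUnit_iff_isUnit_det _).mp hC.isUnit
  have hCt : Cᵀ = C := by
    rw [← Matrix.conjTranspose_eq_transpose_of_trivial, hC.1]
  have hCi : (C⁻¹)ᵀ = C⁻¹ := by rw [Matrix.transpose_nonsing_inv, hCt]
  -- Of the block equations of ΔΩΔ = Ω, two are used: AC - B² = 1 gives A, and BᵀC = CB gives the
  -- symmetry of BC⁻¹.
  have hs := h.mul_Omega_mul
  rw [Omega, Matrix.fromBlocks_multiply, Matrix.fromBlocks_multiply, Matrix.fromBlocks_inj] at hs
  simp only [Matrix.mul_zero, Matrix.mul_one, Matrix.mul_neg, zero_add, add_zero,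
    Matrix.neg_mul] at hs
  obtain ⟨-, h2, -, h4⟩ := hs
  have hBC : Bᵀ * C = C * B := by
    rw [neg_add_eq_zero] at h4
    exact h4.symm
  have hsym : C⁻¹ * Bᵀ = B * C⁻¹ := by
    calc C⁻¹ * Bᵀ = C⁻¹ * (Bᵀ * C) * C⁻¹ := by
          rw [Matrix.mul_assoc, Matrix.mul_nonsing_inv_cancel_right _ _ hu]
      _ = B * C⁻¹ := by rw [hBC, Matrix.nonsing_inv_mul_cancel_left _ _ hu]
  have hA : A = C⁻¹ + B * B * C⁻¹ := by
    have e : A * C = 1 + B * B := by rw [← h2]; abel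
    calc A = A * C * C⁻¹ := (Matrix.mul_nonsing_inv_cancel_right _ _ hu).symm
      _ = C⁻¹ + B * B * C⁻¹ := by rw [e, Matrix.add_mul, Matrix.one_mul]
  have hphase : IsPhaseMatrix (phaseOf B C) := by
    refine ⟨?_, by rw [imMat_phaseOf]; exact hC.inv⟩
    rw [Matrix.IsSymm, phaseOf, Matrix.transpose_add, Matrix.transpose_smul,
      ← Matrix.transpose_map, ← Matrix.transpose_map, Matrix.transpose_neg, Matrix.transpose_mul,
      hCi, hsym]
  refine ⟨hu, hphase, ?_⟩
  rw [sigmaOf, reMat_phaseOf, imMat_phaseOf, Matrix.nonsing_inv_nonsing_inv _ hu]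
  congr 1
  · rw [hA, Matrix.neg_mul, Matrix.nonsing_inv_mul_cancel_right _ _ hu]
    simp [Matrix.mul_assoc]
  · rw [Matrix.neg_mul, Matrix.nonsing_inv_mul_cancel_right _ _ hu, neg_neg]
  · rw [Matrix.mul_neg, neg_neg, ← Matrix.mul_assoc, ← hBC,
      Matrix.mul_nonsing_inv_cancel_right _ _ hu]

end PhaseMatrices

/-! ### Densities and measures attached to pure matrices -/

section Densities

variable {n : ℕ}

theorem IsPure.half_inv_posDef {Δ : Matrix (Fin n ⊕ Fin n) (Fin n ⊕ Fin n) ℝ} (h : IsPure Δ) :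
    ((1 / 2 : ℝ) • Δ⁻¹).PosDef :=
  h.posDef.inv.smul (by norm_num)

theorem half_inv_injOn {Δ Γ : Matrix (Fin n ⊕ Fin n) (Fin n ⊕ Fin n) ℝ} (hΔ : IsPure Δ)
    (hΓ : IsPure Γ) (h : (1 / 2 : ℝ) • Δ⁻¹ = (1 / 2 : ℝ) • Γ⁻¹) : Δ = Γ := by
  have e : Δ⁻¹ = Γ⁻¹ := smul_right_injective _ (by norm_num : (1 / 2 : ℝ) ≠ 0) h
  rw [← Matrix.nonsing_inv_nonsing_inv _ hΔ.isUnit_det, e,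
    Matrix.nonsing_inv_nonsing_inv _ hΓ.isUnit_det]

/-- As det Δ = 1, the determinant of ½Δ⁻¹ is 2^(-2n), which cancels the powers of 2 in the
normalization and leaves π⁻ⁿ. -/
theorem IsPure.gaussianDensity_eq {Δ : Matrix (Fin n ⊕ Fin n) (Fin n ⊕ Fin n) ℝ} (h : IsPure Δ)
    (m u : Phase n) :
    gaussianDensity ((1 / 2 : ℝ) • Δ⁻¹) m u = 1 / Real.pi ^ n * Real.exp
      (-((fun i => u i - m i) ⬝ᵥ Δ *ᵥ (fun i => u i - m i))) := by
  have hinv : ((1 / 2 : ℝ) • Δ⁻¹)⁻¹ = (2 : ℝ) • Δ := by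
    apply Matrix.inv_eq_right_inv
    rw [Matrix.smul_mul, Matrix.mul_smul, smul_smul, Matrix.nonsing_inv_mul _ h.isUnit_det]
    norm_num
  have hdet : (2 * Real.pi) ^ (2 * n) * ((1 / 2 : ℝ) • Δ⁻¹).det = (Real.pi ^ n) ^ 2 := by
    rw [Matrix.det_smul, Matrix.det_nonsing_inv, h.2.1, Ring.inverse_one, mul_one,
      Fintype.card_sum, Fintype.card_fin, ← two_mul, ← mul_pow, ← pow_mul, mul_comm n 2]
    congr 1
    ring
  rw [gaussianDensity, hdet, hinv, Real.sqrt_sq (by positivity), Matrix.smul_mulVec,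
    dotProduct_smul, smul_eq_mul]
  ring_nf

theorem withDensity_gaussianDensity {S : Matrix (Fin n ⊕ Fin n) (Fin n ⊕ Fin n) ℝ}
    (hS : S.PosDef) (m : Phase n) :
    volume.withDensity (fun u => ENNReal.ofReal (gaussianDensity S m u)) =
      multivariateGaussian m S := by
  rw [← withDensity_eq_multivariateGaussian hS m, Fintype.card_sum, Fintype.card_fin, ← two_mul]
  rfl

theorem IsPure.isDensityOfGaussian {Δ : Matrix (Fin n ⊕ Fin n) (Fin n ⊕ Fin n) ℝ} (h : IsPure Δ)
    {m : Phase n} {f : Phase n → ℂ}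
    (hf : ∀ u, f u = ((1 / Real.pi ^ n * Real.exp
      (-((fun i => u i - m i) ⬝ᵥ Δ *ᵥ (fun i => u i - m i))) : ℝ) : ℂ)) :
    IsDensityOfGaussian f ((1 / 2 : ℝ) • Δ⁻¹) m := by
  have hf' : ∀ u, f u = (gaussianDensity ((1 / 2 : ℝ) • Δ⁻¹) m u : ℂ) := fun u => by
    rw [hf u, h.gaussianDensity_eq]
  refine ⟨h.half_inv_posDef, hf', ?_⟩
  simp_rw [hf', Complex.ofReal_re]
  exact withDensity_gaussianDensity h.half_inv_posDef m

theorem IsDensityOfGaussian.unique {f : Phase n → ℂ}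
    {S T : Matrix (Fin n ⊕ Fin n) (Fin n ⊕ Fin n) ℝ} {m k : Phase n}
    (hS : IsDensityOfGaussian f S m) (hT : IsDensityOfGaussian f T k) : S = T ∧ m = k := by
  have h := multivariateGaussian_injOn (x₁ := (S, m)) (x₂ := (T, k)) hS.1.posSemidef
    hT.1.posSemidef (hS.2.2.symm.trans hT.2.2)
  exact ⟨congrArg Prod.fst h, congrArg Prod.snd h⟩

theorem rescaledRotation_eq (u : Phase n) :
    rescaledRotation u = Matrix.toEuclideanCLM (𝕜 := ℝ) (Real.sqrt 2 • Omega n) u := by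
  have e : u.ofLp = Sum.elim (upper u).ofLp (lower u).ofLp := by
    ext i
    cases i <;> rfl
  ext i
  rw [Matrix.ofLp_toEuclideanCLM, Matrix.smul_mulVec, Omega, e, Matrix.fromBlocks_mulVec]
  cases i <;> simp [rescaledRotation, column, Matrix.neg_mulVec]

theorem rescaledRotation_column (q p : Config n) :
    rescaledRotation (column q p) = column (Real.sqrt 2 • p) (-(Real.sqrt 2 • q)) := rfl

theorem IsPure.map_rescaledRotation {Δ : Matrix (Fin n ⊕ Fin n) (Fin n ⊕ Fin n) ℝ} (h : IsPure Δ)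
    (m : Phase n) :
    (multivariateGaussian m ((1 / 2 : ℝ) • Δ⁻¹)).map rescaledRotation =
      multivariateGaussian (rescaledRotation m) Δ := by
  have e : (rescaledRotation : Phase n → Phase n) =
      Matrix.toEuclideanCLM (𝕜 := ℝ) (Real.sqrt 2 • Omega n) := funext rescaledRotation_eq
  rw [e, map_multivariateGaussian _ h.half_inv_posDef.posSemidef]
  congr 1
  conv_rhs => rw [← h.Omega_mul_inv_mul]
  rw [Matrix.transpose_smul]
  simp only [Matrix.smul_mul, Matrix.mul_smul, smul_smul]
  have h2 : Real.sqrt 2 * (1 / 2 * Real.sqrt 2) = 1 := by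
    rw [mul_left_comm, Real.mul_self_sqrt (by norm_num)]
    norm_num
  rw [h2, one_smul]

end Densities

/-! ### Gaussian waves and their Wigner transforms -/

section Waves

variable {n : ℕ}

theorem complex_quadForm_eq (Φ : Matrix (Fin n) (Fin n) ℂ) (v : Fin n → ℝ) :
    (fun i => (v i : ℂ)) ⬝ᵥ Φ *ᵥ (fun i => (v i : ℂ)) =
      ((v ⬝ᵥ reMat Φ *ᵥ v : ℝ) : ℂ) + Complex.I * ((v ⬝ᵥ imMat Φ *ᵥ v : ℝ) : ℂ) := by
  simp only [dotProduct, Matrix.mulVec, Complex.ofReal_sum, Complex.ofReal_mul, Finset.mul_sum,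
    ← Finset.sum_add_distrib]
  refine Finset.sum_congr rfl fun i _ => Finset.sum_congr rfl fun j _ => ?_
  conv_lhs => rw [← Complex.re_add_im (Φ i j)]
  simp only [reMat, imMat, Matrix.map_apply]
  ring

/-- Modulus and argument of a Gaussian wave. -/
theorem gaussianWave_eq (α : ℝ) (s t : Config n) (Φ : Matrix (Fin n) (Fin n) ℂ) (x : Config n) :
    gaussianWave α s t Φ x = ((((imMat Φ).det / Real.pi ^ n) ^ (1 / 4 : ℝ) : ℝ) : ℂ) *
      Complex.exp (Complex.I *
          ((α + s.ofLp ⬝ᵥ x.ofLp + (x - t).ofLp ⬝ᵥ reMat Φ *ᵥ (x - t).ofLp / 2 : ℝ) : ℂ) -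
        (((x - t).ofLp ⬝ᵥ imMat Φ *ᵥ (x - t).ofLp / 2 : ℝ) : ℂ)) := by
  have h := complex_quadForm_eq Φ (x - t).ofLp
  have e : (fun i => (((x - t).ofLp i : ℝ) : ℂ)) = fun i => ((x i - t i : ℝ) : ℂ) := rfl
  rw [e] at h
  rw [gaussianWave, h, mul_right_comm _ _ (Complex.exp _), ← Complex.exp_add, ← Complex.exp_add,
    mul_comm]
  congr 2
  simp only [dotProduct]
  push_cast
  ring_nf
  rw [Complex.I_sq]
  ring

theorem gaussianWave_phase (α β : ℝ) (s t : Config n) (Φ : Matrix (Fin n) (Fin n) ℂ)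
    (x : Config n) :
    gaussianWave (α + β) s t Φ x = Complex.exp (Complex.I * α) * gaussianWave β s t Φ x := by
  rw [gaussianWave, gaussianWave, Complex.ofReal_add, mul_add, Complex.exp_add]
  ring

theorem continuous_gaussianWave (α : ℝ) (s t : Config n) (Φ : Matrix (Fin n) (Fin n) ℂ) :
    Continuous (gaussianWave α s t Φ) := by
  unfold gaussianWave
  simp only [dotProduct, Matrix.mulVec]
  fun_prop

/-- The squared modulus is a constant times exp(-(x - t)ᵀY(x - t)), an integrable Gaussian. -/
theorem memLp_gaussianWave (α : ℝ) (s t : Config n) {Φ : Matrix (Fin n) (Fin n) ℂ}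
    (h : IsPhaseMatrix Φ) : MemLp (gaussianWave α s t Φ) 2 volume := by
  rw [memLp_two_iff_integrable_sq_norm (continuous_gaussianWave α s t Φ).aestronglyMeasurable]
  have hi := ((integrable_exp_neg_quadForm h.2).comp_sub_right t).const_mul
    (|((imMat Φ).det / Real.pi ^ n) ^ (1 / 4 : ℝ)| ^ 2)
  refine hi.congr (Filter.Eventually.of_forall fun x => ?_)
  simp only [gaussianWave_eq, norm_mul, Complex.norm_real, Real.norm_eq_abs, Complex.norm_exp]
  rw [mul_pow, ← Real.exp_nat_mul]
  congr 2
  simp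
  ring

/-- The integrand of the Wigner transform of a Gaussian wave. -/
theorem wigner_integrand (α : ℝ) (s t : Config n) {Φ : Matrix (Fin n) (Fin n) ℂ}
    (h : IsPhaseMatrix Φ) (q p ξ : Config n) :
    starRingEnd ℂ (gaussianWave α s t Φ (q + ξ)) * gaussianWave α s t Φ (q - ξ) *
        Complex.exp (2 * Complex.I * ((∑ i, ξ i * p i : ℝ) : ℂ)) =
      ((Real.sqrt ((imMat Φ).det / Real.pi ^ n) *
          Real.exp (-((q - t).ofLp ⬝ᵥ imMat Φ *ᵥ (q - t).ofLp)) : ℝ) : ℂ) *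
        Complex.exp (-((ξ.ofLp ⬝ᵥ imMat Φ *ᵥ ξ.ofLp : ℝ) : ℂ) + 2 * Complex.I *
          ((((p - s).ofLp - reMat Φ *ᵥ (q - t).ofLp) ⬝ᵥ ξ.ofLp : ℝ) : ℂ)) := by
  have hdet : 0 ≤ (imMat Φ).det / Real.pi ^ n := by
    have := h.2.det_pos
    positivity
  have hN : ((((imMat Φ).det / Real.pi ^ n) ^ (1 / 4 : ℝ) : ℝ) : ℂ) *
      ((((imMat Φ).det / Real.pi ^ n) ^ (1 / 4 : ℝ) : ℝ) : ℂ) =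
      (Real.sqrt ((imMat Φ).det / Real.pi ^ n) : ℂ) := by
    rw [← Complex.ofReal_mul, Real.sqrt_eq_rpow, ← sq, ← Real.rpow_natCast, ← Real.rpow_mul hdet]
    norm_num
  have hsym : ∀ (M : Matrix (Fin n) (Fin n) ℝ), Mᵀ = M → ∀ v w : Fin n → ℝ,
      v ⬝ᵥ M *ᵥ w = w ⬝ᵥ M *ᵥ v := by
    intro M hM v w
    rw [Matrix.dotProduct_mulVec, ← Matrix.mulVec_transpose, hM, dotProduct_comm]
  set a : Fin n → ℝ := (q - t).ofLp with ha
  set x : Fin n → ℝ := ξ.ofLp with hx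
  have e1 : (q + ξ - t).ofLp = a + x := by
    ext i
    simp [ha, hx]
    ring
  have e2 : (q - ξ - t).ofLp = a - x := by
    ext i
    simp [ha, hx]
    ring
  have e3 : ∑ i, ξ i * p i = p.ofLp ⬝ᵥ x := by
    simp [dotProduct, hx, mul_comm]
  have hX := hsym _ h.reMat_transpose x a
  have hY := hsym _ h.imMat_transpose x a
  have hb : (reMat Φ *ᵥ a) ⬝ᵥ x = a ⬝ᵥ reMat Φ *ᵥ x := by rw [dotProduct_comm, hX]
  rw [gaussianWave_eq, gaussianWave_eq, map_mul, Complex.conj_ofReal, ← Complex.exp_conj, e1, e2,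
    e3, Complex.ofReal_mul, ← hN, Complex.ofReal_exp]
  rw [mul_mul_mul_comm, mul_assoc (_ * _), ← Complex.exp_add, ← Complex.exp_add,
    mul_assoc (_ * _), ← Complex.exp_add]
  congr 2
  -- What remains is an identity of exponents: symmetry of X and Y merges the cross terms, which
  -- cancel for Y and survive as -2i aᵀXξ for X.
  simp only [map_sub, map_mul, Complex.conj_I, Complex.conj_ofReal, WithLp.ofLp_add,
    WithLp.ofLp_sub, ← hx, Matrix.mulVec_add, Matrix.mulVec_sub, dotProduct_add, dotProduct_sub,
    add_dotProduct, sub_dotProduct, hX, hY, hb]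
  push_cast
  ring

/-- This completes the square in b; the shifted variable b - Xa is the frequency of the Fourier
integral in `wigner_integrand`. -/
theorem sigmaOf_quadForm {Φ : Matrix (Fin n) (Fin n) ℂ} (h : IsPhaseMatrix Φ)
    (a b : Fin n → ℝ) :
    Sum.elim a b ⬝ᵥ sigmaOf Φ *ᵥ Sum.elim a b =
      a ⬝ᵥ imMat Φ *ᵥ a +
        (b - reMat Φ *ᵥ a) ⬝ᵥ (imMat Φ)⁻¹ *ᵥ (b - reMat Φ *ᵥ a) := by
  have hX : ∀ v w : Fin n → ℝ, (reMat Φ *ᵥ v) ⬝ᵥ w = v ⬝ᵥ reMat Φ *ᵥ w := by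
    intro v w
    rw [Matrix.dotProduct_mulVec, ← Matrix.mulVec_transpose, h.reMat_transpose]
  rw [sigmaOf, Matrix.fromBlocks_mulVec]
  simp only [Sum.elim_comp_inl, Sum.elim_comp_inr, sumElim_dotProduct_sumElim, Matrix.add_mulVec,
    Matrix.neg_mulVec, Matrix.mulVec_sub, dotProduct_add, dotProduct_sub, dotProduct_neg,
    sub_dotProduct, hX, ← Matrix.mulVec_mulVec]
  ring

theorem wigner_gaussianWave (α : ℝ) (s t : Config n) {Φ : Matrix (Fin n) (Fin n) ℂ}
    (h : IsPhaseMatrix Φ) (u : Phase n) :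
    wigner (gaussianWave α s t Φ) u = ((1 / Real.pi ^ n * Real.exp
      (-((fun i => u i - column t s i) ⬝ᵥ sigmaOf Φ *ᵥ (fun i => u i - column t s i))) : ℝ) : ℂ) := by
  have hu : (fun i => u i - column t s i) =
      Sum.elim (upper u - t).ofLp (lower u - s).ofLp := by
    ext i
    cases i <;> rfl
  rw [wigner]
  simp_rw [wigner_integrand α s t h]
  rw [integral_const_mul, integral_cexp_quadForm h.2, hu, sigmaOf_quadForm h, Fintype.card_fin]
  have hd := h.2.det_pos
  -- The normalization of the wave cancels the constant of the Gaussian integral, so only the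
  -- prefactor π⁻ⁿ survives.
  have hone : Real.sqrt ((imMat Φ).det / Real.pi ^ n) * Real.sqrt (Real.pi ^ n / (imMat Φ).det) =
      1 := by
    rw [← Real.sqrt_mul (by positivity), div_mul_div_cancel₀ (by positivity), div_self hd.ne',
      Real.sqrt_one]
  rw [neg_add, Real.exp_add]
  have hpi : (1 / (Real.pi : ℂ) ^ n) = ((1 / Real.pi ^ n : ℝ) : ℂ) := by push_cast; rfl
  rw [hpi, ← Complex.ofReal_mul, ← Complex.ofReal_mul, mul_mul_mul_comm (Real.sqrt _), hone,
    one_mul]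

theorem IsGaussianWith.wigner_eq {ψ : L2 n} {s t : Config n} {Φ : Matrix (Fin n) (Fin n) ℂ}
    (h : IsGaussianWith ψ s t Φ) (u : Phase n) :
    wigner ψ u = ((1 / Real.pi ^ n * Real.exp
      (-((fun i => u i - column t s i) ⬝ᵥ sigmaOf Φ *ᵥ (fun i => u i - column t s i))) : ℝ) : ℂ) := by
  obtain ⟨hΦ, α, -, hψ⟩ := h
  rw [wigner_congr_ae hψ, wigner_gaussianWave α s t hΦ]

theorem IsGaussianWith.isDensityOfGaussian {ψ : L2 n} {s t : Config n}
    {Φ : Matrix (Fin n) (Fin n) ℂ} (h : IsGaussianWith ψ s t Φ) :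
    IsDensityOfGaussian (wigner ψ) ((1 / 2 : ℝ) • (sigmaOf Φ)⁻¹) (column t s) :=
  h.1.sigmaOf_isPure.isDensityOfGaussian h.wigner_eq

theorem column_inj {q p q' p' : Config n} (h : column q p = column q' p') : q = q' ∧ p = p' := by
  constructor
  · ext i
    exact congrArg (fun u : Phase n => u (Sum.inl i)) h
  · ext i
    exact congrArg (fun u : Phase n => u (Sum.inr i)) h

theorem column_upper_lower (u : Phase n) : column (upper u) (lower u) = u := by
  ext i
  cases i <;> rfl

/-- The Wigner transform of a Gaussian state determines its parameters. -/
theorem IsGaussianWith.parameters_unique {ψ : L2 n} {s t : Config n}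
    {Φ : Matrix (Fin n) (Fin n) ℂ} (h : IsGaussianWith ψ s t Φ) {s' t' : Config n}
    {Ψ : Matrix (Fin n) (Fin n) ℂ} (hΨ : IsPhaseMatrix Ψ)
    (hd : IsDensityOfGaussian (wigner ψ) ((1 / 2 : ℝ) • (sigmaOf Ψ)⁻¹) (column t' s')) :
    s = s' ∧ t = t' ∧ Φ = Ψ := by
  obtain ⟨h1, h2⟩ := h.isDensityOfGaussian.unique hd
  obtain ⟨ht, hs⟩ := column_inj h2
  exact ⟨hs, ht, sigmaOf_injective h.1 hΨ
    (half_inv_injOn h.1.sigmaOf_isPure hΨ.sigmaOf_isPure h1)⟩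

theorem exists_isGaussianWith (s t : Config n) {Φ : Matrix (Fin n) (Fin n) ℂ}
    (h : IsPhaseMatrix Φ) : ∃ ψ : L2 n, IsGaussianWith ψ s t Φ :=
  ⟨(memLp_gaussianWave 0 s t h).toLp _, h, 0, ⟨le_rfl, Real.two_pi_pos⟩, MemLp.coeFn_toLp _⟩

theorem IsGaussianWith.exists_phase {ψ χ : L2 n} {s t : Config n}
    {Φ : Matrix (Fin n) (Fin n) ℂ} (hψ : IsGaussianWith ψ s t Φ) (hχ : IsGaussianWith χ s t Φ) :
    ∃ θ : ℝ, χ = Complex.exp (Complex.I * θ) • ψ := by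
  obtain ⟨-, α, -, hα⟩ := hψ
  obtain ⟨-, β, -, hβ⟩ := hχ
  refine ⟨β - α, Lp.ext ?_⟩
  filter_upwards [hα, hβ, Lp.coeFn_smul (Complex.exp (Complex.I * ((β - α : ℝ) : ℂ))) ψ]
    with x h1 h2 h3
  rw [h3, h2, Pi.smul_apply, h1, smul_eq_mul, ← gaussianWave_phase, sub_add_cancel]

end Waves

end GaussWigner

/-! ### The main theorem -/

open GaussWigner in
theorem mainTheorem7 (n : ℕ) :
    -- every admissible choice of parameters defines a Gaussian state in `L²(ℝⁿ)`
    (∀ (α : ℝ) (s t : Config n) (Φ : Matrix (Fin n) (Fin n) ℂ), IsPhaseMatrix Φ →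
      MeasureTheory.MemLp (gaussianWave α s t Φ) 2 MeasureTheory.volume) ∧
    -- the Wigner transform of a Gaussian state
    (∀ (ψ : L2 n) (s t : Config n) (Φ : Matrix (Fin n) (Fin n) ℂ), IsGaussianWith ψ s t Φ →
      IsPure (sigmaOf Φ) ∧
      (∀ u : Phase n, wigner ψ u = ((1 / Real.pi ^ n * Real.exp
        (-((fun i => u i - column t s i) ⬝ᵥ sigmaOf Φ *ᵥ (fun i => u i - column t s i))) : ℝ) : ℂ)) ∧
      IsDensityOfGaussian (wigner ψ) ((1 / 2 : ℝ) • (sigmaOf Φ)⁻¹) (column t s) ∧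
      (MeasureTheory.volume.withDensity (fun u => ENNReal.ofReal (wigner ψ u).re)).map
          rescaledRotation =
        ProbabilityTheory.multivariateGaussian
          (column (Real.sqrt 2 • s) (-(Real.sqrt 2 • t))) (sigmaOf Φ)) ∧
    -- the converse, with an explicit phase matrix
    (∀ A B C : Matrix (Fin n) (Fin n) ℝ, A.IsSymm → C.IsSymm →
      IsPure (Matrix.fromBlocks A B Bᵀ C) →
      IsUnit C.det ∧ IsPhaseMatrix (phaseOf B C) ∧
      sigmaOf (phaseOf B C) = Matrix.fromBlocks A B Bᵀ C ∧
      ∀ (s t : Config n) (ψ : GaussianState n),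
        IsDensityOfGaussian (wigner ψ.1)
            ((1 / 2 : ℝ) • (Matrix.fromBlocks A B Bᵀ C)⁻¹) (column t s) ↔
          IsGaussianWith ψ.1 s t (phaseOf B C)) ∧
    -- distinct parameters give distinct Gaussian distributions
    Set.InjOn (fun x : Matrix (Fin n ⊕ Fin n) (Fin n ⊕ Fin n) ℝ × Phase n =>
        ProbabilityTheory.multivariateGaussian x.2 ((1 / 2 : ℝ) • x.1⁻¹)) {x | IsPure x.1} ∧
    -- the Wigner transform is a bijection from Gaussian states modulo global phase
    Set.BijOn (wignerRay n) Set.univ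
      {W | ∃ (Δ : Matrix (Fin n ⊕ Fin n) (Fin n ⊕ Fin n) ℝ) (m : Phase n),
        IsPure Δ ∧ IsDensityOfGaussian W ((1 / 2 : ℝ) • Δ⁻¹) m} := by
  refine ⟨fun α s t Φ h => memLp_gaussianWave α s t h, ?_, ?_, ?_, ?_, ?_, ?_⟩
  · intro ψ s t Φ h
    refine ⟨h.1.sigmaOf_isPure, h.wigner_eq, h.isDensityOfGaussian, ?_⟩
    rw [h.isDensityOfGaussian.2.2, h.1.sigmaOf_isPure.map_rescaledRotation,
      rescaledRotation_column]
  · intro A B C _ _ hpure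
    obtain ⟨hC, hΦ, hσ⟩ := hpure.phaseOf_blocks
    refine ⟨hC, hΦ, hσ, fun s t ψ => ?_⟩
    rw [← hσ]
    refine ⟨fun hd => ?_, fun h => h.isDensityOfGaussian⟩
    -- The state comes with some parameters of its own; its Wigner transform forces them to be the
    -- prescribed ones.
    obtain ⟨ψ, s', t', Ψ, h⟩ := ψ
    obtain ⟨rfl, rfl, rfl⟩ := h.parameters_unique hΦ hd
    exact h
  · rintro ⟨Δ, m⟩ hΔ ⟨Γ, k⟩ hΓ h
    change IsPure Δ at hΔ
    change IsPure Γ at hΓ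
    have e := multivariateGaussian_injOn (x₁ := ((1 / 2 : ℝ) • Δ⁻¹, m))
      (x₂ := ((1 / 2 : ℝ) • Γ⁻¹, k)) hΔ.half_inv_posDef.posSemidef hΓ.half_inv_posDef.posSemidef h
    have e₂ : m = k := congrArg Prod.snd e
    rw [half_inv_injOn hΔ hΓ (congrArg Prod.fst e), e₂]
  · rintro x -
    induction x using Quotient.inductionOn with
    | h ψ =>
      obtain ⟨ψ, s, t, Φ, h⟩ := ψ
      exact ⟨sigmaOf Φ, column t s, h.1.sigmaOf_isPure, h.isDensityOfGaussian⟩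
  · rintro x - y - hxy
    induction x using Quotient.inductionOn with
    | h ψ =>
      induction y using Quotient.inductionOn with
      | h χ =>
        obtain ⟨ψ, s, t, Φ, hψ⟩ := ψ
        obtain ⟨χ, s', t', Ψ, hχ⟩ := χ
        change wigner ψ = wigner χ at hxy
        have hd := hχ.isDensityOfGaussian
        rw [← hxy] at hd
        obtain ⟨rfl, rfl, rfl⟩ := hψ.parameters_unique hχ.1 hd
        exact Quotient.sound (hψ.exists_phase hχ)
  · rintro W ⟨Δ, m, hΔ, hW⟩
    obtain ⟨A, B, C, rfl⟩ : ∃ A B C : Matrix (Fin n) (Fin n) ℝ,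
        Δ = Matrix.fromBlocks A B Bᵀ C := by
      refine ⟨Δ.toBlocks₁₁, Δ.toBlocks₁₂, Δ.toBlocks₂₂, ?_⟩
      conv_lhs => rw [← Matrix.fromBlocks_toBlocks Δ]
      congr 1
      ext i j
      exact (hΔ.1.apply (Sum.inl j) (Sum.inr i))
    obtain ⟨-, hΦ, hσ⟩ := hΔ.phaseOf_blocks
    -- The mean is the column [t; s], so s is the lower block of m and t the upper one.
    obtain ⟨ψ, hψ⟩ := exists_isGaussianWith (lower m) (upper m) hΦ
    refine ⟨Quotient.mk _ ⟨ψ, _, _, _, hψ⟩, Set.mem_univ _, ?_⟩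
    change wigner ψ = W
    have hd := hψ.isDensityOfGaussian
    rw [hσ, column_upper_lower] at hd
    -- Both functions are given everywhere by the same explicit density, so they agree pointwise and
    -- not just almost everywhere.
    funext u
    rw [hd.2.1, hW.2.1]
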